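/- For $S\subseteq[m]$ let $\chi_S(x)=(-1)^{\sum_{i\in S}x_i}$ on $\{0,1\}^m$. Every $\phi:\{0,1\}^m\to\mathbb{R}$ is uniquely $\phi=\sum_S\hat\phi(S)\chi_S$; its exact degree is the largest $|S|$ with $\hat\phi(S)\neq 0$ (and $0$ if $\phi=0$). The $\delta$-approximate degree of $f:\{0,1\}^m\to\{-1,1\}$ is the smallest integer $d$ such that some $\phi$ of exact degree $d$ satisfies $\max_x|f(x)-\phi(x)|\le\delta$. For $g:\{0,1\}^n\to\{-1,1\}$ and $k\ge 2$ let $G^g_k:(\{0,1\}^n)^k\to\{-1,1\}$ be given by $G^g_k(x,y^1,\dots,y^{k-1})=g(x_{i_1}x_{i_2}\cdots x_{i_t}0^{n-t})$, where $i_1<\dots<i_t$ are the positions $i$ with $y^1_i=\dots=y^{k-1}_i=1$. In the $k$-party number-on-the-forehead model each player sees all inputs except its own; the players write bits on a public blackboard, the contents of the blackboard determine who speaks next, when the protocol stops, and the output. A randomized (public-coin) protocol is a probability distribution over deterministic ones; its cost is the largest number of bits written, over all inputs and coin outcomes. It computes $F$ with advantage $\epsilon$ if on every input its output equals the value of $F$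 with probability at least $1/2+\epsilon$. $R^\epsilon_k(F)$ is the least cost of a randomized protocol that computes $F$ with advantage $\epsilon$ ($+\infty$ if there is none). **Theorem.** Let $k\ge 2$ be an integer, let $f:\{0,1\}^m\to\{-1,1\}$ have $\delta$-approximate degree $d\ge 1$, let $$n\ \ge\ \Big(\frac{2^{2^k}(k-1)e}{d}\Big)^{k-1}m^k ,$$ and let $f':\{0,1\}^n\to\{-1,1\}$ satisfy $f(z)=f'(z0^{n-m})$ for all $z\in\{0,1\}^m$. Then for every real $\epsilon$ with $\delta+2\epsilon-1>0$, $$R^\epsilon_k\big(G^{f'}_k\big)\ \ge\ \frac{d}{2^{k-1}}+\log_2(\delta+2\epsilon-1).$$ -/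

import Mathlib

noncomputable section

namespace NOF

/-! ### Fourier expansion and approximate degree on the cube -/

/-- The character `χ_S(x) = (-1)^{∑_{i ∈ S} x_i}`. -/
def chi {m : ℕ} (S : Finset (Fin m)) (x : Fin m → Bool) : ℝ :=
  (-1) ^ ∑ i ∈ S, (x i).toNat

/-- The Fourier coefficient `⟨φ, χ_S⟩`, with respect to the uniform distribution. -/
def fourierCoeff {m : ℕ} (φ : (Fin m → Bool) → ℝ) (S : Finset (Fin m)) : ℝ :=
  (∑ x : Fin m → Bool, φ x * chi S x) / 2 ^ m

open Classical in
/-- The exact degree: the largest `|S|` with a nonzero Fourier coefficient at `S`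
(and `0` for the zero function). -/
def exactDegree {m : ℕ} (φ : (Fin m → Bool) → ℝ) : ℕ :=
  (Finset.univ.filter fun S : Finset (Fin m) => fourierCoeff φ S ≠ 0).sup Finset.card

/-- `d` is the `δ`-approximate degree of the sign-valued function `f`. -/
def IsApproxDegree {m : ℕ} (δ : ℝ) (f : (Fin m → Bool) → ℤˣ) (d : ℕ) : Prop :=
  IsLeast {d : ℕ | ∃ φ : (Fin m → Bool) → ℝ, exactDegree φ = d ∧
    ∀ x, |((f x : ℤ) : ℝ) - φ x| ≤ δ} d

/-! ### Number-on-the-forehead protocols -/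

/-- Deterministic number-on-the-forehead protocols for players `ι`, where player `i` has an
element of `X i` on the forehead. A node of the tree is a state of the blackboard: the player
who speaks there writes one bit, which depends on the inputs of all the other players, and
the protocol goes on in the subtree given by that bit. At a leaf it stops with an output. -/
inductive Protocol {ι : Type} (X : ι → Type) : Type
  | leaf (out : ℤˣ) : Protocol X
  | node (i : ι) (msg : ((j : {j : ι // j ≠ i}) → X j) → Bool)
      (next : Bool → Protocol X) : Protocol X

namespace Protocol

variable {ι : Type} {X : ι → Type}

/-- The output of the protocol on an input. -/
def output : Protocol X → ((j : ι) → X j) → ℤˣ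
  | leaf out, _ => out
  | node _ msg next, x => (next (msg fun j => x j)).output x

/-- The number of bits written on the blackboard on an input. -/
def bits : Protocol X → ((j : ι) → X j) → ℕ
  | leaf _, _ => 0
  | node _ msg next, x => (next (msg fun j => x j)).bits x + 1

end Protocol

/-- A randomized (public coin) protocol: a probability distribution on the deterministic
protocols. -/
abbrev RandProtocol {ι : Type} (X : ι → Type) : Type := PMF (Protocol X)

namespace RandProtocol

variable {ι : Type} {X : ι → Type}

/-- On every input and for every outcome of the coins, at most `c` bits are exchanged. -/
def CostLE (P : RandProtocol X) (c : ℕ) : Prop :=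
  ∀ π ∈ P.support, ∀ x : (j : ι) → X j, π.bits x ≤ c

/-- On every input, the output agrees with `F` with probability at least `1/2 + ε`. -/
def ComputesWithAdvantage (P : RandProtocol X) (F : ((j : ι) → X j) → ℤˣ) (ε : ℝ) : Prop :=
  ∀ x : (j : ι) → X j,
    1 / 2 + ε ≤ (P.toOuterMeasure {π : Protocol X | π.output x = F x}).toReal

end RandProtocol

/-- The randomized number-on-the-forehead communication complexity of `F` with advantage `ε`
(it is `⊤` if no protocol computes `F` with advantage `ε`). -/
def randComplexity {ι : Type} {X : ι → Type} (ε : ℝ) (F : ((j : ι) → X j) → ℤˣ) : ℕ∞ :=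
  ⨅ (c : ℕ) (_ : ∃ P : RandProtocol X, P.CostLE c ∧ P.ComputesWithAdvantage F ε), (c : ℕ∞)

/-! ### The masking scheme -/

/-- The string `x_{i₁} x_{i₂} … x_{iₜ} 0^{n-t}`, where `i₁ < … < iₜ` are the elements of `S`. -/
def select {n : ℕ} (S : Finset (Fin n)) (x : Fin n → Bool) : Fin n → Bool := fun j =>
  if h : (j : ℕ) < S.card then x (S.orderEmbOfFin rfl ⟨j, h⟩) else false

/-- The function `G^g_k`. Player `0` has `x = w 0` on the forehead and the players `i ≠ 0` have
the strings `y^i = w i`; the columns where all `y^i` are one select the bits of `x`. -/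
def maskedFun {n : ℕ} (k : ℕ) [NeZero k] (g : (Fin n → Bool) → ℤˣ)
    (w : Fin k → Fin n → Bool) : ℤˣ :=
  g (select (Finset.univ.filter fun c : Fin n => ∀ i : Fin k, i ≠ 0 → w i c = true) (w 0))

/-- The string `z 0^{n-m}`, for `m ≤ n`. -/
def padZero {m : ℕ} (n : ℕ) (z : Fin m → Bool) : Fin n → Bool := fun j =>
  if h : (j : ℕ) < m then z ⟨j, h⟩ else false

end NOF

end

namespace NOF

open Finset
open scoped BigOperators

/-! ### Dual witness for the approximate degree -/

/-! The proof is the generalized discrepancy method driven by a dual polynomial. By duality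
(`exists_dual_witness`) there is a weight `ψ` of ℓ¹-norm 1 that is orthogonal to all functions of
degree below `d` and has correlation above `δ` with `f`.

Put `k = K + 1` and cut the string `x` into `m` blocks of `ℓ ^ K` cells. In each block every other
player chooses one of `ℓ` coordinates, so that together they select one cell per block, and on these
inputs the masked function is `f` of the selected bits (`maskedFun_encode`). Weight the inputs by
`ψ` of the selected bits.

Against a cylinder intersection, `K` applications of Cauchy–Schwarz (`abs_expect_cylinder_pow_le`)
leave a product of `ψ` over the `2 ^ K` windows of a random cube. In blocks without a collision
these windows read independent bits. With fewer than `d` collisions every factor therefore averages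
to zero, and `d` or more collisions are rare when `ℓ` is large (`expect_collisions_tail_le`). So the
correlation is at most `B = 2 ^ (-d / 2 ^ K)` (`discrepancy_pow_le`).

A protocol of `c` bits splits into cylinder intersections and has correlation at most `2 ^ c * B`.
Its mean output is within `1 - 2 * ε` of the target function, whence `δ < 2 ^ c * B + 1 - 2 * ε`. -/

lemma fourierCoeff_add {m : ℕ} (φ φ' : (Fin m → Bool) → ℝ) (S : Finset (Fin m)) :
    fourierCoeff (φ + φ') S = fourierCoeff φ S + fourierCoeff φ' S := by
  simp only [fourierCoeff, Pi.add_apply, add_mul, sum_add_distrib, add_div]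

lemma fourierCoeff_smul {m : ℕ} (a : ℝ) (φ : (Fin m → Bool) → ℝ) (S : Finset (Fin m)) :
    fourierCoeff (a • φ) S = a * fourierCoeff φ S := by
  simp only [fourierCoeff, Pi.smul_apply, smul_eq_mul, mul_assoc, ← mul_sum, mul_div_assoc]

/-- The functions whose Fourier expansion only has characters of degree less than `d`. -/
def lowDegree (m d : ℕ) : Submodule ℝ ((Fin m → Bool) → ℝ) where
  carrier := {φ | ∀ S : Finset (Fin m), d ≤ S.card → fourierCoeff φ S = 0}
  add_mem' h h' S hS := by rw [fourierCoeff_add, h S hS, h' S hS, add_zero]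
  zero_mem' S _ := by simp [fourierCoeff]
  smul_mem' a φ h S hS := by rw [fourierCoeff_smul, h S hS, mul_zero]

lemma exactDegree_lt_of_mem_lowDegree {m d : ℕ} (hd : 1 ≤ d) {φ : (Fin m → Bool) → ℝ}
    (hφ : φ ∈ lowDegree m d) : exactDegree φ < d := by
  classical
  -- The supremum may be empty, with value 0; this is where `1 ≤ d` enters.
  rw [exactDegree, Finset.sup_lt_iff hd]
  intro S hS
  by_contra h
  exact (mem_filter.1 hS).2 (hφ S (not_lt.1 h))

lemma chi_flip {m : ℕ} {S : Finset (Fin m)} {i : Fin m} (hi : i ∈ S) (x : Fin m → Bool) :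
    chi S (Function.update x i (!x i)) = -chi S x := by
  unfold chi
  rw [← add_sum_erase _ _ hi, ← add_sum_erase _ _ hi]
  have : ∑ j ∈ S.erase i, (Function.update x i (!x i) j).toNat
      = ∑ j ∈ S.erase i, (x j).toNat :=
    sum_congr rfl fun j hj => by rw [Function.update_of_ne (ne_of_mem_erase hj)]
  rw [this, Function.update_self, pow_add, pow_add]
  cases x i <;> simp

/-- A function that depends on fewer than `d` coordinates has degree less than `d`. -/
lemma mem_lowDegree_of_dependsOn {m d : ℕ} {h : (Fin m → Bool) → ℝ} (R : Finset (Fin m))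
    (hR : R.card < d) (hh : ∀ x y, (∀ i ∈ R, x i = y i) → h x = h y) : h ∈ lowDegree m d := by
  intro S hS
  obtain ⟨i, hiS, hiR⟩ := exists_mem_notMem_of_card_lt_card (hR.trans_le hS)
  have hinv : Function.Involutive fun x : Fin m → Bool => Function.update x i (!x i) := by
    intro x
    simp
  have key : ∑ x, h x * chi S x = ∑ x, -(h x * chi S x) := by
    refine Fintype.sum_equiv hinv.toPerm _ _ fun x => ?_
    rw [Function.Involutive.coe_toPerm, chi_flip hiS, hh (Function.update x i (!x i)) x]
    · ring
    · intro j hj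
      rw [Function.update_of_ne]
      rintro rfl
      exact hiR hj
  rw [sum_neg_distrib] at key
  rw [fourierCoeff, self_eq_neg.1 key, zero_div]

/-- The dual characterisation of the approximate degree. -/
theorem exists_dual_witness {m d : ℕ} {δ : ℝ} (hd : 1 ≤ d) {f : (Fin m → Bool) → ℤˣ}
    (hf : IsApproxDegree δ f d) :
    ∃ ψ : (Fin m → Bool) → ℝ, ∑ z, |ψ z| = 1 ∧ δ < ∑ z, ψ z * ((f z : ℤ) : ℝ) ∧
      ∀ h ∈ lowDegree m d, ∑ z, ψ z * h z = 0 := by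
  set F : (Fin m → Bool) → ℝ := fun z => ((f z : ℤ) : ℝ) with hF
  obtain ⟨φ₀, -, hφ₀⟩ := hf.1
  have hδ : 0 ≤ δ := (abs_nonneg _).trans (hφ₀ fun _ => false)
  have hdisj : Disjoint (Metric.closedBall F δ) (lowDegree m d : Set ((Fin m → Bool) → ℝ)) := by
    rw [Set.disjoint_left]
    intro φ hφ hφV
    refine absurd (hf.2 ⟨φ, rfl, fun x => ?_⟩)
      (not_le.2 (exactDegree_lt_of_mem_lowDegree hd hφV))
    rw [Metric.mem_closedBall, dist_comm] at hφ
    simpa [Real.dist_eq] using (dist_le_pi_dist F φ x).trans hφ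
  obtain ⟨L, u, v, hLu, huv, hLv⟩ := geometric_hahn_banach_compact_closed
    (convex_closedBall F δ) (isCompact_closedBall F δ) (lowDegree m d).convex
    (Submodule.closed_of_finiteDimensional _) hdisj
  have hv0 : v < 0 := by simpa using hLv 0 (lowDegree m d).zero_mem
  have hLV : ∀ h ∈ lowDegree m d, L h = 0 := by
    intro h hh
    by_contra hne
    -- A functional bounded below on a subspace vanishes there: this multiple of `h` has value
    -- exactly `v`.
    have := hLv ((v / L h) • h) ((lowDegree m d).smul_mem _ hh)
    rw [map_smul, smul_eq_mul, div_mul_cancel₀ _ hne] at this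
    exact lt_irrefl _ this
  set ψ : (Fin m → Bool) → ℝ := fun z => -L (Pi.single z 1) with hψ
  have hLψ : ∀ h, ∑ z, ψ z * h z = -L h := by
    intro h
    have : h = ∑ z, h z • (Pi.single z 1 : (Fin m → Bool) → ℝ) := by
      ext z
      simp [Finset.sum_apply, Pi.single_apply]
    conv_rhs => rw [this]
    rw [map_sum, ← sum_neg_distrib]
    refine sum_congr rfl fun z _ => ?_
    rw [map_smul, smul_eq_mul]
    ring
  have hgt : δ * ∑ z, |ψ z| < ∑ z, ψ z * F z := by
    -- This is the point of the ball with the least correlation with `ψ`.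
    have hmem : (fun z => F z - δ * SignType.sign (ψ z)) ∈ Metric.closedBall F δ := by
      rw [Metric.mem_closedBall, dist_pi_le_iff hδ]
      intro z
      rw [Real.dist_eq, sub_sub_cancel_left, abs_neg, abs_mul, abs_of_nonneg hδ]
      refine mul_le_of_le_one_right hδ ?_
      rcases lt_trichotomy (ψ z) 0 with h | h | h <;> simp [h]
    have h1 := (hLu _ hmem).trans (huv.trans hv0)
    have h2 := hLψ fun z => F z - δ * SignType.sign (ψ z)
    have h3 : ∑ z, ψ z * (F z - δ * SignType.sign (ψ z))
        = ∑ z, ψ z * F z - δ * ∑ z, |ψ z| := by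
      rw [mul_sum, ← sum_sub_distrib]
      refine sum_congr rfl fun z _ => ?_
      rw [← self_mul_sign (ψ z)]
      ring
    rw [h3] at h2
    linarith
  have hpos : 0 < ∑ z, |ψ z| := by
    refine lt_of_le_of_ne (sum_nonneg fun _ _ => abs_nonneg _) fun h0 => ?_
    have hz : ∀ z, ψ z = 0 := fun z => abs_eq_zero.1
      ((sum_eq_zero_iff_of_nonneg fun _ _ => abs_nonneg _).1 h0.symm z (mem_univ z))
    simp [hz] at hgt
  refine ⟨fun z => ψ z / ∑ z, |ψ z|, ?_, ?_, fun h hh => ?_⟩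
  · simp_rw [abs_div, abs_of_pos hpos]
    rw [← sum_div, div_self hpos.ne']
  · simp_rw [div_mul_eq_mul_div]
    rw [← sum_div, lt_div_iff₀ hpos]
    exact hgt
  · simp_rw [div_mul_eq_mul_div]
    rw [← sum_div, hLψ, hLV h hh, neg_zero, zero_div]

/-! ### Protocols and cylinder intersections -/

/-- A function with values in `[-1, 1]` that does not depend on the input of player `i`. -/
def IsCylinder {ι : Type} {X : ι → Type} (i : ι) (φ : ((j : ι) → X j) → ℝ) : Prop :=
  (∀ w w', (∀ j, j ≠ i → w j = w' j) → φ w = φ w') ∧ ∀ w, |φ w| ≤ 1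

/-- A functional that is small on cylinder intersections is small on protocols: the general
form, inside a cylinder intersection. -/
theorem Protocol.abs_map_prod_mul_output_le {ι : Type} [Fintype ι] {X : ι → Type}
    (Λ : (((j : ι) → X j) → ℝ) →ₗ[ℝ] ℝ) {B : ℝ}
    (hB : ∀ φ : ι → ((j : ι) → X j) → ℝ, (∀ i, IsCylinder i (φ i)) →
      |Λ fun w => ∏ i, φ i w| ≤ B) (π : Protocol X) :
    ∀ (c : ℕ) (φ : ι → ((j : ι) → X j) → ℝ), (∀ i, IsCylinder i (φ i)) →
      (∀ w, ∏ i, φ i w ≠ 0 → π.bits w ≤ c) →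
      |Λ fun w => (∏ i, φ i w) * ((π.output w : ℤ) : ℝ)| ≤ 2 ^ c * B := by
  classical
  induction π with
  | leaf out =>
    intro c φ hφ _
    have hB0 : 0 ≤ B := (abs_nonneg _).trans (hB φ hφ)
    have : (fun w => (∏ i, φ i w) * (((Protocol.leaf out : Protocol X).output w : ℤ) : ℝ))
        = ((out : ℤ) : ℝ) • fun w => ∏ i, φ i w := by
      ext w
      simp [Protocol.output, mul_comm]
    rw [this, map_smul, smul_eq_mul, abs_mul]
    have hout : |((out : ℤ) : ℝ)| = 1 := by
      rcases Int.units_eq_one_or out with rfl | rfl <;> simp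
    rw [hout, one_mul]
    exact (hB φ hφ).trans (le_mul_of_one_le_left hB0 (one_le_pow₀ one_le_two))
  | node i msg next ih =>
    intro c φ hφ hc
    have hB0 : 0 ≤ B := (abs_nonneg _).trans (hB φ hφ)
    cases c with
    -- A node writes at least one bit, so the budget 0 forces the product to vanish everywhere.
    | zero =>
      have : (fun w => (∏ i, φ i w) * (((Protocol.node i msg next).output w : ℤ) : ℝ)) = 0 := by
        ext w
        by_cases h : ∏ i, φ i w = 0
        · simp [h]
        · simpa [Protocol.bits] using hc w h
      rw [this, map_zero, abs_zero]
      positivity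
    | succ c =>
      -- The bit written by player `i` does not depend on the input of `i`, so its indicator can be
      -- absorbed into the cylinder of `i`.
      set φ' : Bool → ι → ((j : ι) → X j) → ℝ := fun b j w =>
        φ j w * if j = i then (if (msg fun l => w l) = b then 1 else 0) else 1 with hφ'
      have hprod : ∀ b w, ∏ j, φ' b j w
          = (∏ j, φ j w) * if (msg fun l => w l) = b then 1 else 0 := by
        intro b w
        simp only [hφ', prod_mul_distrib, prod_ite_eq', mem_univ, if_true]
      have hcyl : ∀ b j, IsCylinder j (φ' b j) := by
        intro b j
        constructor
        · intro w w' hw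
          simp only [hφ']
          rw [(hφ j).1 w w' hw]
          by_cases hji : j = i
          · subst hji
            have : (fun l : {l // l ≠ j} => w l) = fun l : {l // l ≠ j} => w' l :=
              funext fun l => hw l l.2
            rw [this]
          · simp [hji]
        · intro w
          simp only [hφ']
          rw [abs_mul]
          refine mul_le_one₀ ((hφ j).2 w) (abs_nonneg _) ?_
          split_ifs <;> simp
      have hsplit : (fun w => (∏ j, φ j w) * (((Protocol.node i msg next).output w : ℤ) : ℝ))
          = (fun w => (∏ j, φ' true j w) * (((next true).output w : ℤ) : ℝ))
            + fun w => (∏ j, φ' false j w) * (((next false).output w : ℤ) : ℝ) := by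
        ext w
        simp only [Pi.add_apply, hprod, Protocol.output]
        cases msg fun l => w l <;> simp
      have hbits : ∀ b w, ∏ j, φ' b j w ≠ 0 → (next b).bits w ≤ c := by
        intro b w hw
        rw [hprod] at hw
        have hm : (msg fun l => w l) = b := by
          by_contra h
          simp [h] at hw
        have := hc w (left_ne_zero_of_mul hw)
        simp only [Protocol.bits, hm] at this
        omega
      rw [hsplit, map_add]
      have h1 := ih true c (φ' true) (hcyl true) (hbits true)
      have h2 := ih false c (φ' false) (hcyl false) (hbits false)
      refine (abs_add_le _ _).trans ?_
      rw [pow_succ]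
      linarith

theorem Protocol.abs_map_output_le {ι : Type} [Fintype ι] {X : ι → Type}
    (Λ : (((j : ι) → X j) → ℝ) →ₗ[ℝ] ℝ) {B : ℝ}
    (hB : ∀ φ : ι → ((j : ι) → X j) → ℝ, (∀ i, IsCylinder i (φ i)) →
      |Λ fun w => ∏ i, φ i w| ≤ B) (π : Protocol X) (c : ℕ) (hc : ∀ w, π.bits w ≤ c) :
    |Λ fun w => ((π.output w : ℤ) : ℝ)| ≤ 2 ^ c * B := by
  simpa using Protocol.abs_map_prod_mul_output_le Λ hB π c (fun _ _ => 1)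
    (fun i => ⟨fun _ _ _ => rfl, fun _ => by simp⟩) fun w _ => hc w

/-- The generalized discrepancy method: a signed weight `θ` on finitely many inputs that
correlates well with `F` and badly with cylinder intersections. -/
theorem RandProtocol.correlation_le {ι : Type} [Fintype ι] {X : ι → Type} {Ω : Type*} [Fintype Ω]
    (θ : Ω → ℝ) (w : Ω → (j : ι) → X j) (hθ : ∑ a, |θ a| = 1) {B : ℝ}
    (hB : ∀ φ : ι → ((j : ι) → X j) → ℝ, (∀ i, IsCylinder i (φ i)) →
      |∑ a, θ a * ∏ i, φ i (w a)| ≤ B)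
    {F : ((j : ι) → X j) → ℤˣ} {ε : ℝ} {c : ℕ} (P : RandProtocol X) (hc : P.CostLE c)
    (hP : P.ComputesWithAdvantage F ε) :
    ∑ a, θ a * ((F (w a) : ℤ) : ℝ) ≤ 2 ^ c * B + (1 - 2 * ε) := by
  classical
  set Λ : (((j : ι) → X j) → ℝ) →ₗ[ℝ] ℝ :=
    { toFun := fun Q => ∑ a, θ a * Q (w a)
      map_add' := fun Q Q' => by simp [mul_add, sum_add_distrib]
      map_smul' := fun r Q => by simp [mul_sum, mul_left_comm] } with hΛ
  have hone : HasSum (fun π => (P π).toReal) 1 := by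
    have := (ENNReal.summable_toReal P.tsum_coe_ne_top).hasSum
    rwa [← ENNReal.tsum_toReal_eq P.apply_ne_top, P.tsum_coe, ENNReal.toReal_one] at this
  have hprob : ∀ x, HasSum (fun π => (P π).toReal * if π.output x = F x then 1 else 0)
      (P.toOuterMeasure {π : Protocol X | π.output x = F x}).toReal := by
    intro x
    rw [PMF.toOuterMeasure_apply, ENNReal.tsum_toReal_eq]
    · have : ∀ π, (P π).toReal * (if π.output x = F x then 1 else 0)
          = (Set.indicator {π : Protocol X | π.output x = F x} P π).toReal := by
        intro π
        by_cases h : π.output x = F x <;> simp [h]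
      simp_rw [this]
      refine (Summable.of_nonneg_of_le (fun _ => ENNReal.toReal_nonneg) (fun π => ?_)
        hone.summable).hasSum
      exact ENNReal.toReal_mono (P.apply_ne_top π) (Set.indicator_le_self' (fun _ _ => zero_le) π)
    · intro π
      exact ((Set.indicator_le_self' (fun _ _ => zero_le) π).trans_lt
        (P.apply_ne_top π).lt_top).ne
  set p : ((j : ι) → X j) → ℝ := fun x =>
    (P.toOuterMeasure {π : Protocol X | π.output x = F x}).toReal with hp
  have hp1 : ∀ x, p x ≤ 1 := fun x => hasSum_le (fun π => by
    split_ifs <;> simp) (hprob x) hone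
  have hmean : ∀ x, HasSum (fun π => (P π).toReal * ((π.output x : ℤ) : ℝ))
      (((F x : ℤ) : ℝ) * (2 * p x - 1)) := by
    intro x
    have h : ∀ π : Protocol X, (P π).toReal * ((π.output x : ℤ) : ℝ) = ((F x : ℤ) : ℝ) *
        (2 * ((P π).toReal * if π.output x = F x then 1 else 0) - (P π).toReal) := by
      intro π
      rcases Int.units_eq_one_or (π.output x) with h | h <;>
        rcases Int.units_eq_one_or (F x) with h' | h' <;> rw [h, h'] <;> simp <;> ring
    rw [funext h]
    exact (((hprob x).mul_left 2).sub hone).mul_left ((F x : ℤ) : ℝ)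
  have hsum : HasSum (fun π => (P π).toReal * Λ fun x => ((π.output x : ℤ) : ℝ))
      (∑ a, θ a * (((F (w a) : ℤ) : ℝ) * (2 * p (w a) - 1))) := by
    have h : ∀ π : Protocol X, ((P π).toReal * Λ fun x => ((π.output x : ℤ) : ℝ))
        = ∑ a, θ a * ((P π).toReal * ((π.output (w a) : ℤ) : ℝ)) := by
      intro π
      simp only [hΛ, LinearMap.coe_mk, AddHom.coe_mk, mul_sum]
      exact sum_congr rfl fun a _ => by ring
    rw [funext h]
    exact hasSum_sum fun a _ => (hmean (w a)).mul_left (θ a)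
  have hprot : ∑ a, θ a * (((F (w a) : ℤ) : ℝ) * (2 * p (w a) - 1)) ≤ 2 ^ c * B := by
    have := hone.mul_right (2 ^ c * B)
    rw [one_mul] at this
    refine hasSum_le (fun π => ?_) hsum this
    by_cases hπ : π ∈ P.support
    · exact mul_le_mul_of_nonneg_left ((le_abs_self _).trans
        (Protocol.abs_map_output_le Λ hB π c (hc π hπ))) ENNReal.toReal_nonneg
    · rw [(P.apply_eq_zero_iff π).2 hπ]
      simp
  -- The mean output is `F * (2 * p - 1)`, so it misses `F` by `2 - 2 * p ≤ 1 - 2 * ε`.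
  have herr : ∑ a, θ a * (((F (w a) : ℤ) : ℝ) * (2 - 2 * p (w a))) ≤ 1 - 2 * ε := by
    rw [← one_mul (1 - 2 * ε), ← hθ, sum_mul]
    refine sum_le_sum fun a _ => ?_
    refine (le_abs_self _).trans ?_
    have h1 := hP (w a)
    have h2 := hp1 (w a)
    have hF : |((F (w a) : ℤ) : ℝ)| = 1 := by
      rcases Int.units_eq_one_or (F (w a)) with h | h <;> simp [h]
    rw [abs_mul, abs_mul, hF, one_mul]
    refine mul_le_mul_of_nonneg_left ?_ (abs_nonneg _)
    rw [abs_of_nonneg (by linarith)]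
    change 1 / 2 + ε ≤ p (w a) at h1
    linarith
  have : ∑ a, θ a * ((F (w a) : ℤ) : ℝ) = ∑ a, θ a * (((F (w a) : ℤ) : ℝ) * (2 * p (w a) - 1))
      + ∑ a, θ a * (((F (w a) : ℤ) : ℝ) * (2 - 2 * p (w a))) := by
    rw [← sum_add_distrib]
    exact sum_congr rfl fun a _ => by ring
  linarith

/-! ### Resampling bits of a uniform string -/

lemma prod_expect {U κ : Type*} [Fintype U] [DecidableEq U] [Fintype κ] (g : U → κ → ℝ) :
    ∏ u, 𝔼 z, g u z = 𝔼 z : U → κ, ∏ u, g u (z u) := by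
  simp only [Fintype.expect_eq_sum_div_card, prod_div_distrib, prod_const, card_univ,
    Fintype.card_fun, Nat.cast_pow, prod_univ_sum, Fintype.piFinset_univ]

lemma expect_xor {I : Type*} [Fintype I] [DecidableEq I] (h : (I → Bool) → ℝ) (s : I → Bool) :
    𝔼 x : I → Bool, h (fun i => xor (x i) (s i)) = 𝔼 x, h x := by
  have hinv : Function.Involutive fun x : I → Bool => fun i => xor (x i) (s i) := by
    intro x
    simp
  exact Fintype.expect_equiv hinv.toPerm _ _ fun x => rfl

/-- Windows `ι u` into a uniform string `x` whose coordinates outside `R` are all distinct can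
be resampled independently outside `R`. -/
theorem expect_prod_resample {U I B : Type*} [Fintype U] [DecidableEq U] [Fintype I]
    [DecidableEq I] [Fintype B] [DecidableEq B] (ψ : (I → Bool) → ℝ) (ι : U → I → B)
    (R : Finset I)
    (hι : ∀ u u' i i', i ∉ R → ι u i = ι u' i' → u = u' ∧ i = i') :
    𝔼 x : B → Bool, ∏ u, ψ (fun i => x (ι u i))
      = 𝔼 x : B → Bool, ∏ u, 𝔼 z, ψ (R.piecewise (fun i => x (ι u i)) z) := by
  classical
  have hshift : ∀ z : U → I → Bool, ∃ s : B → Bool,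
      ∀ u i, s (ι u i) = if i ∈ R then false else z u i := by
    intro z
    refine ⟨fun b => decide (∃ u i, i ∉ R ∧ ι u i = b ∧ z u i = true), fun u i => ?_⟩
    rw [Bool.eq_iff_iff, decide_eq_true_iff]
    constructor
    · rintro ⟨u', i', hi', h, hz⟩
      obtain ⟨rfl, rfl⟩ := hι _ _ _ _ hi' h
      simp [hi', hz]
    · intro h
      by_cases hi : i ∈ R
      · simp [hi] at h
      · exact ⟨u, i, hi, rfl, by simpa [hi] using h⟩
  choose s hs using hshift
  -- Translation by `s z` preserves the uniform distribution and adds `z u` to window `u` outside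
  -- `R`.
  have hfix : ∀ z : U → I → Bool, 𝔼 x : B → Bool, ∏ u, ψ (fun i => x (ι u i)) = 𝔼 x : B → Bool,
      ∏ u, ψ (R.piecewise (fun i => x (ι u i)) fun i => xor (x (ι u i)) (z u i)) := by
    intro z
    rw [← expect_xor _ (s z)]
    refine expect_congr rfl fun x _ => prod_congr rfl fun u _ => congrArg ψ (funext fun i => ?_)
    by_cases hi : i ∈ R <;> simp [hs, hi]
  calc 𝔼 x : B → Bool, ∏ u, ψ (fun i => x (ι u i))
      = 𝔼 _z : U → I → Bool, 𝔼 x : B → Bool, ∏ u, ψ (fun i => x (ι u i)) :=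
        (Fintype.expect_const _).symm
    _ = 𝔼 z : U → I → Bool, 𝔼 x : B → Bool,
          ∏ u, ψ (R.piecewise (fun i => x (ι u i)) fun i => xor (x (ι u i)) (z u i)) :=
        expect_congr rfl fun z _ => hfix z
    _ = 𝔼 x : B → Bool, ∏ u, 𝔼 z, ψ (R.piecewise (fun i => x (ι u i)) z) := by
        rw [expect_comm]
        refine expect_congr rfl fun x _ => ?_
        rw [← prod_expect fun u (z : I → Bool) =>
          ψ (R.piecewise (fun i => x (ι u i)) fun i => xor (x (ι u i)) (z i))]
        refine prod_congr rfl fun u _ => ?_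
        simp only [Bool.xor_comm (x _)]
        exact expect_xor (fun z => ψ (R.piecewise (fun i => x (ι u i)) z)) fun i => x (ι u i)

/-- A window of distinct coordinates of a uniform string is uniform. -/
lemma expect_comp_injective {I B : Type*} [Fintype I] [DecidableEq I] [Fintype B]
    [DecidableEq B] (h : (I → Bool) → ℝ) {ι : I → B} (hι : Function.Injective ι) :
    𝔼 x : B → Bool, h (fun i => x (ι i)) = 𝔼 z, h z := by
  simpa using expect_prod_resample (U := Unit) h (fun _ => ι) ∅
    fun _ _ _ _ _ h => ⟨rfl, hι h⟩

/-- Averaging over the coordinates outside `R` is correlating with a subcube on `R`. -/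
lemma expect_piecewise {m : ℕ} (ψ : (Fin m → Bool) → ℝ) (R : Finset (Fin m))
    (v : Fin m → Bool) :
    𝔼 z, ψ (R.piecewise v z)
      = ∑ z, ψ z * if ∀ i ∈ R, z i = v i then (2 : ℝ) ^ R.card / 2 ^ m else 0 := by
  classical
  have hsum : ∀ z, ψ (R.piecewise v z) = ∑ z', ψ z' * if R.piecewise v z = z' then 1 else 0 := by
    intro z
    simp
  simp_rw [hsum]
  rw [expect_sum_comm]
  refine sum_congr rfl fun z' _ => ?_
  rw [← mul_expect]
  congr 1
  rw [Fintype.expect_eq_sum_div_card, sum_boole]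
  by_cases h : ∀ i ∈ R, z' i = v i
  · have hset : (univ.filter fun z => R.piecewise v z = z')
        = Fintype.piFinset fun i => if i ∈ R then univ else {z' i} := by
      ext z
      simp only [mem_filter, mem_univ, true_and, Fintype.mem_piFinset, funext_iff]
      refine forall_congr' fun i => ?_
      by_cases hi : i ∈ R
      · simp [hi, h i hi]
      · simp [hi]
    rw [if_pos h, hset, Fintype.card_piFinset]
    have : ∀ i, #(if i ∈ R then univ else {z' i} : Finset Bool) = if i ∈ R then 2 else 1 := by
      intro i
      split_ifs <;> simp
    rw [prod_congr rfl fun i _ => this i]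
    simp
  · rw [if_neg h, filter_eq_empty_iff.2]
    · simp
    · intro z _ hz
      refine h fun i hi => ?_
      rw [← hz]
      simp [hi]

/-- The indicator of a subcube fixed on `R` depends on fewer than `d` coordinates, so `ψ` is
orthogonal to it. -/
lemma expect_piecewise_eq_zero {m d : ℕ} {ψ : (Fin m → Bool) → ℝ}
    (hψ : ∀ h ∈ lowDegree m d, ∑ z, ψ z * h z = 0) {R : Finset (Fin m)} (hR : R.card < d)
    (v : Fin m → Bool) : 𝔼 z, ψ (R.piecewise v z) = 0 := by
  rw [expect_piecewise]
  refine hψ (fun z => if ∀ i ∈ R, z i = v i then (2 : ℝ) ^ R.card / 2 ^ m else 0)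
    (mem_lowDegree_of_dependsOn R hR fun x y hxy => ?_)
  have : (∀ i ∈ R, x i = v i) ↔ ∀ i ∈ R, y i = v i :=
    forall₂_congr fun i hi => by rw [hxy i hi]
  simp only [this]

lemma abs_expect_piecewise_le {m : ℕ} {ψ : (Fin m → Bool) → ℝ} (hψ : ∑ z, |ψ z| = 1)
    (R : Finset (Fin m)) (v : Fin m → Bool) :
    |𝔼 z, ψ (R.piecewise v z)| ≤ 2 ^ R.card / 2 ^ m := by
  have hsum : (2 : ℝ) ^ R.card / 2 ^ m = ∑ z, |ψ z| * (2 ^ R.card / 2 ^ m) := by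
    rw [← sum_mul, hψ, one_mul]
  rw [expect_piecewise]
  refine le_of_le_of_eq ?_ hsum.symm
  refine (abs_sum_le_sum_abs _ _).trans (sum_le_sum fun z _ => ?_)
  rw [abs_mul]
  refine mul_le_mul_of_nonneg_left ?_ (abs_nonneg _)
  split_ifs
  · rw [abs_of_nonneg (by positivity)]
  · rw [abs_zero]
    positivity

/-! ### The cube norm bound for cylinder intersections -/

lemma abs_expect_pow_le {α : Type*} [Fintype α] [Nonempty α] (g : α → ℝ) (N : ℕ) :
    |𝔼 a, g a| ^ N ≤ 𝔼 a, |g a| ^ N := by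
  refine (pow_le_pow_left₀ (abs_nonneg _) (abs_expect_le _ _) N).trans ?_
  have hc : (0 : ℝ) < Fintype.card α := by exact_mod_cast Fintype.card_pos
  have := Real.pow_arith_mean_le_arith_mean_pow univ (fun _ : α => (Fintype.card α : ℝ)⁻¹)
    (fun a => |g a|) (fun _ _ => by positivity) (by simp [hc.ne']) (fun _ _ => abs_nonneg _) N
  simpa only [Fintype.expect_eq_sum_div_card, ← mul_sum, div_eq_inv_mul] using this

lemma sq_expect_mul_le {α : Type*} [Fintype α] [Nonempty α] (f g : α → ℝ)
    (hf : ∀ a, |f a| ≤ 1) : (𝔼 a, f a * g a) ^ 2 ≤ 𝔼 a, g a ^ 2 := by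
  refine (expect_mul_sq_le_sq_mul_sq univ f g).trans
    (mul_le_of_le_one_left (expect_nonneg fun _ _ => sq_nonneg _) ?_)
  exact expect_le univ_nonempty fun a _ => (sq_le_one_iff_abs_le_one _).2 (hf a)

lemma expect_fin_cons {K : ℕ} {Y : Type*} [Fintype Y] (h : (Fin (K + 1) → Y) → ℝ) :
    𝔼 y, h y = 𝔼 a, 𝔼 y : Fin K → Y, h (Fin.cons a y) := by
  rw [← expect_product' univ univ fun a (y : Fin K → Y) => h (Fin.cons a y), univ_product_univ]
  exact (Fintype.expect_equiv (Fin.consEquiv fun _ => Y) _ _ fun _ => rfl).symm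

lemma prod_fin_cons {K : ℕ} (h : (Fin (K + 1) → Bool) → ℝ) :
    ∏ u, h u = ∏ u : Fin K → Bool, h (Fin.cons true u) * h (Fin.cons false u) := by
  rw [← Fintype.prod_equiv (Fin.consEquiv fun _ => Bool) (fun p => h (Fin.cons p.1 p.2)) _
    fun _ => rfl, Fintype.prod_prod_type_right]
  simp

/-- The corner `u` of the cube spanned by the pairs `p`. -/
def corner {K : ℕ} {Y : Type*} (p : Fin K → Y × Y) (u : Fin K → Bool) : Fin K → Y :=
  fun j => bif u j then (p j).1 else (p j).2

lemma corner_cons {K : ℕ} {Y : Type*} (q : Y × Y) (p : Fin K → Y × Y) (b : Bool)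
    (u : Fin K → Bool) :
    corner (Fin.cons q p : Fin (K + 1) → Y × Y) (Fin.cons b u)
      = Fin.cons (bif b then q.1 else q.2) (corner p u) := by
  ext j
  refine Fin.cases ?_ (fun j => ?_) j <;> simp [corner]

/-- Each Cauchy–Schwarz step removes the factor that ignores one coordinate of `y` and doubles that
coordinate into a pair; products of the remaining factors at the two values are again bounded
cylinders. The string `x` is never doubled, and `φ₀`, which ignores `x`, leaves the inner average at
the end. -/
theorem abs_expect_cylinder_pow_le {X Y : Type*} [Fintype X] [Nonempty X] [Fintype Y]
    [Nonempty Y] (K : ℕ) (ψ : X → (Fin K → Y) → ℝ) (φ₀ : (Fin K → Y) → ℝ)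
    (φ : Fin K → X → (Fin K → Y) → ℝ) (hφ₀ : ∀ y, |φ₀ y| ≤ 1) (hφ : ∀ j x y, |φ j x y| ≤ 1)
    (hφ' : ∀ j x y y', (∀ l, l ≠ j → y l = y' l) → φ j x y = φ j x y') :
    |𝔼 y, 𝔼 x, ψ x y * (φ₀ y * ∏ j, φ j x y)| ^ 2 ^ K
      ≤ 𝔼 p : Fin K → Y × Y, |𝔼 x, ∏ u, ψ x (corner p u)| := by
  induction K with
  | zero =>
    simp only [pow_zero, pow_one, univ_eq_empty, prod_empty, mul_one, ← expect_mul]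
    rw [Fintype.expect_eq_sum_div_card, Fintype.expect_eq_sum_div_card]
    simp only [univ_unique, sum_singleton, Fintype.card_unique, Nat.cast_one, div_one,
      prod_singleton]
    rw [abs_mul]
    rw [Subsingleton.elim (corner _ _) (default : Fin 0 → Y)]
    exact mul_le_of_le_one_right (abs_nonneg _) (hφ₀ _)
  | succ K ih =>
    obtain ⟨a₀⟩ := ‹Nonempty Y›
    set g : Y → X × (Fin K → Y) → ℝ := fun a q => ψ q.1 (Fin.cons a q.2) *
      (φ₀ (Fin.cons a q.2) * ∏ j : Fin K, φ j.succ q.1 (Fin.cons a q.2)) with hg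
    -- The value `a₀` is arbitrary, since `φ 0` ignores coordinate 0 of `y`.
    set φ' : X × (Fin K → Y) → ℝ := fun q => φ 0 q.1 (Fin.cons a₀ q.2) with hφ'def
    have hrew : 𝔼 y, 𝔼 x, ψ x y * (φ₀ y * ∏ j, φ j x y) = 𝔼 q, φ' q * 𝔼 a, g a q := by
      rw [expect_fin_cons]
      simp_rw [mul_expect]
      rw [expect_comm univ univ (fun q a => φ' q * g a q)]
      refine expect_congr rfl fun a _ => ?_
      rw [← univ_product_univ, expect_product, expect_comm]
      refine expect_congr rfl fun x _ => expect_congr rfl fun y _ => ?_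
      rw [Fin.prod_univ_succ, hφ' 0 x (Fin.cons a y) (Fin.cons a₀ y)]
      · simp only [hg, hφ'def]
        ring
      · intro l hl
        obtain ⟨l, rfl⟩ := Fin.exists_succ_eq.2 hl
        simp
    have hsq : (𝔼 q, φ' q * 𝔼 a, g a q) ^ 2 ≤ 𝔼 s : Y × Y, 𝔼 q, g s.1 q * g s.2 q := by
      refine (sq_expect_mul_le _ _ fun q => hφ _ _ _).trans_eq ?_
      rw [expect_comm]
      refine expect_congr rfl fun q _ => ?_
      rw [sq, Fintype.expect_mul_expect, ← univ_product_univ, expect_product]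
    have hstep : ∀ s : Y × Y, |𝔼 q, g s.1 q * g s.2 q| ^ 2 ^ K
        ≤ 𝔼 p : Fin K → Y × Y, |𝔼 x, ∏ u, (ψ x (Fin.cons s.1 (corner p u)) *
            ψ x (Fin.cons s.2 (corner p u)))| := by
      intro s
      refine le_of_eq_of_le ?_ (ih (fun x y => ψ x (Fin.cons s.1 y) * ψ x (Fin.cons s.2 y))
        (fun y => φ₀ (Fin.cons s.1 y) * φ₀ (Fin.cons s.2 y))
        (fun j x y => φ j.succ x (Fin.cons s.1 y) * φ j.succ x (Fin.cons s.2 y)) ?_ ?_ ?_)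
      · congr 2
        rw [← univ_product_univ, expect_product, expect_comm]
        refine expect_congr rfl fun y _ => expect_congr rfl fun x _ => ?_
        simp only [hg, prod_mul_distrib]
        ring
      · intro y
        rw [abs_mul]
        exact mul_le_one₀ (hφ₀ _) (abs_nonneg _) (hφ₀ _)
      · intro j x y
        rw [abs_mul]
        exact mul_le_one₀ (hφ _ _ _) (abs_nonneg _) (hφ _ _ _)
      · intro j x y y' hy
        have : ∀ a, φ j.succ x (Fin.cons a y) = φ j.succ x (Fin.cons a y') := by
          intro a
          refine hφ' _ _ _ _ fun l => ?_
          refine Fin.cases (fun _ => by simp) (fun l hl => ?_) l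
          simpa using hy l fun h => hl (by rw [h])
        simp only [this]
    rw [hrew, pow_succ', pow_mul, sq_abs]
    refine (pow_le_pow_left₀ (sq_nonneg _) (hsq.trans (le_abs_self _)) _).trans ?_
    refine (abs_expect_pow_le _ _).trans ?_
    refine (expect_le_expect fun s _ => hstep s).trans_eq ?_
    rw [expect_fin_cons]
    refine expect_congr rfl fun s _ => expect_congr rfl fun p _ => ?_
    congr 1
    refine expect_congr rfl fun x _ => ?_
    rw [prod_fin_cons]
    simp only [corner_cons, cond_true, cond_false]

/-! ### Collision statistics of a random cube -/

/-- The blocks in which two opposite corners of the cube agree in some direction. -/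
def collisions {K m ℓ : ℕ} (p : Fin K → (Fin m → Fin ℓ) × (Fin m → Fin ℓ)) : Finset (Fin m) :=
  univ.filter fun i => ∃ j, (p j).1 i = (p j).2 i

lemma expect_eval {K : ℕ} {T : Type*} [Fintype T] [Nonempty T] (g : T → ℝ) (j : Fin K) :
    𝔼 s : Fin K → T, g (s j) = 𝔼 t, g t := by
  have h := prod_expect fun (l : Fin K) (t : T) => if l = j then g t else 1
  simp only [prod_ite_eq', mem_univ, if_true] at h
  rw [← h, ← mul_prod_erase univ _ (mem_univ j), prod_eq_one fun l hl => ?_]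
  · simp
  · simp [ne_of_mem_erase hl]

lemma expect_diagonal (ℓ : ℕ) [NeZero ℓ] :
    𝔼 t : Fin ℓ × Fin ℓ, (if t.1 = t.2 then (1 : ℝ) else 0) = 1 / ℓ := by
  rw [← univ_product_univ, expect_product]
  simp

/-- The generating function of the number of colliding blocks. -/
theorem expect_pow_card_collisions_le {K m ℓ : ℕ} [NeZero ℓ] {c : ℝ} (hc : 0 ≤ c) :
    𝔼 p : Fin K → (Fin m → Fin ℓ) × (Fin m → Fin ℓ), c ^ (collisions p).card
      ≤ (1 + c * K / ℓ) ^ m := by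
  classical
  set h : (Fin K → Fin ℓ × Fin ℓ) → ℝ := fun s => if ∃ j, (s j).1 = (s j).2 then c else 1 with hh
  have hpow : ∀ p : Fin K → (Fin m → Fin ℓ) × (Fin m → Fin ℓ),
      c ^ (collisions p).card = ∏ i, h fun j => ((p j).1 i, (p j).2 i) := by
    intro p
    simp only [hh, collisions, prod_ite, prod_const, one_pow, mul_one]
  -- Transposed, a random cube is `m` independent blocks.
  set e : (Fin K → (Fin m → Fin ℓ) × (Fin m → Fin ℓ)) ≃ (Fin m → Fin K → Fin ℓ × Fin ℓ) :=
    { toFun := fun p i j => ((p j).1 i, (p j).2 i)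
      invFun := fun q j => (fun i => (q i j).1, fun i => (q i j).2)
      left_inv := fun _ => rfl
      right_inv := fun _ => rfl }
  have hprod : 𝔼 p : Fin K → (Fin m → Fin ℓ) × (Fin m → Fin ℓ), c ^ (collisions p).card
      = (𝔼 s, h s) ^ m := by
    rw [Fintype.expect_equiv e _ (fun q => ∏ i, h (q i)) hpow,
      ← prod_expect fun (_ : Fin m) s => h s]
    simp
  rw [hprod]
  refine pow_le_pow_left₀ (expect_nonneg fun s _ => ?_) ?_ m
  · simp only [hh]
    split_ifs <;> linarith
  -- Union bound over the `K` directions, each colliding with probability `1 / ℓ`.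
  calc 𝔼 s, h s
      ≤ 𝔼 s : Fin K → Fin ℓ × Fin ℓ, (1 + ∑ j, c * if (s j).1 = (s j).2 then 1 else 0) := by
        refine expect_le_expect fun s _ => ?_
        have hterm : ∀ j, 0 ≤ c * if (s j).1 = (s j).2 then 1 else 0 := fun j => by
          split_ifs <;> simp [hc]
        by_cases hs : ∃ j, (s j).1 = (s j).2
        · obtain ⟨j, hj⟩ := id hs
          have := single_le_sum (fun j _ => hterm j) (mem_univ j)
          simp only [hj, if_true, mul_one] at this
          simp only [hh, hs, if_true]
          linarith
        · simp only [hh, hs, if_false]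
          have := sum_nonneg fun j (_ : j ∈ univ) => hterm j
          linarith
    _ = 1 + c * K / ℓ := by
        rw [expect_add_distrib, Fintype.expect_const, expect_sum_comm]
        have : ∀ j : Fin K, 𝔼 s : Fin K → Fin ℓ × Fin ℓ,
            (c * if (s j).1 = (s j).2 then 1 else 0) = c * (1 / ℓ) := by
          intro j
          rw [← mul_expect, expect_eval (fun t : Fin ℓ × Fin ℓ => if t.1 = t.2 then (1 : ℝ) else 0) j,
            expect_diagonal]
        simp only [this, sum_const, card_univ, Fintype.card_fin, nsmul_eq_mul]
        ring

/-! ### Discrepancy of the masked function -/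

/-- The cells of the string `x` selected by `y`, one in each of the `m` blocks. -/
def window {K m ℓ : ℕ} (y : Fin K → Fin m → Fin ℓ) (i : Fin m) : Fin m × (Fin K → Fin ℓ) :=
  (i, fun j => y j i)

lemma window_injective {K m ℓ : ℕ} (y : Fin K → Fin m → Fin ℓ) :
    Function.Injective (window y) := fun _ _ h => congrArg Prod.fst h

/-- A cell records its block, and in a block without collisions the two ends of every pair differ,
so the cell also determines the corner. -/
lemma window_corner_inj {K m ℓ : ℕ} (p : Fin K → (Fin m → Fin ℓ) × (Fin m → Fin ℓ))
    (u u' : Fin K → Bool) (i i' : Fin m) (hi : i ∉ collisions p)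
    (h : window (corner p u) i = window (corner p u') i') : u = u' ∧ i = i' := by
  obtain rfl : i = i' := congrArg Prod.fst h
  refine ⟨funext fun j => ?_, rfl⟩
  have hj : corner p u j i = corner p u' j i := congrFun (congrArg Prod.snd h) j
  have hne : (p j).1 i ≠ (p j).2 i := fun h => hi (by simpa [collisions] using ⟨j, h⟩)
  unfold corner at hj
  cases hu : u j <;> cases hu' : u' j <;> simp only [hu, hu', cond_true, cond_false] at hj
  · rfl
  · exact absurd hj.symm hne
  · exact absurd hj hne
  · rfl

/-- Resampling outside the collision set `R` turns each of the `2 ^ K` factors into a subcube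
average of `2 ^ m * ψ`, which is zero if `R.card < d` and at most `2 ^ R.card` in absolute value in
any case. -/
lemma abs_expect_prod_window_le {K m d ℓ : ℕ} {ψ : (Fin m → Bool) → ℝ} (hψ : ∑ z, |ψ z| = 1)
    (hψd : ∀ h ∈ lowDegree m d, ∑ z, ψ z * h z = 0)
    (p : Fin K → (Fin m → Fin ℓ) × (Fin m → Fin ℓ)) :
    |𝔼 x : Fin m × (Fin K → Fin ℓ) → Bool,
        ∏ u, 2 ^ m * ψ (fun i => x (window (corner p u) i))|
      ≤ if d ≤ (collisions p).card then ((2 : ℝ) ^ 2 ^ K) ^ (collisions p).card else 0 := by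
  rw [expect_prod_resample (fun z => 2 ^ m * ψ z) (fun u => window (corner p u)) (collisions p)
    (window_corner_inj p)]
  simp_rw [← mul_expect]
  split_ifs with h
  · refine (abs_expect_le _ _).trans (expect_le univ_nonempty fun x _ => ?_)
    rw [abs_prod, ← pow_mul, mul_comm, pow_mul]
    refine (prod_le_prod (fun _ _ => abs_nonneg _) fun u _ => ?_).trans_eq
      (b := ∏ _u : Fin K → Bool, (2 : ℝ) ^ (collisions p).card) (by simp)
    rw [abs_mul, abs_of_pos (by positivity : (0 : ℝ) < 2 ^ m), ← le_div_iff₀' (by positivity)]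
    exact abs_expect_piecewise_le hψ _ _
  · rw [expect_eq_zero fun x _ => ?_, abs_zero]
    refine prod_eq_zero (mem_univ fun _ => true) ?_
    rw [expect_piecewise_eq_zero hψd (not_le.1 h), mul_zero]

/-- Exponential Markov inequality with parameter `t = 2e`: the moment costs at most `e ^ d` by the
choice of `ℓ`, and `t ^ (-d) * e ^ d = 2 ^ (-d)`. -/
lemma expect_collisions_tail_le {K m d ℓ : ℕ} [NeZero ℓ]
    (hℓ : 2 * Real.exp 1 * m * 2 ^ 2 ^ K * K ≤ d * ℓ) :
    𝔼 p : Fin K → (Fin m → Fin ℓ) × (Fin m → Fin ℓ),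
        (if d ≤ (collisions p).card then ((2 : ℝ) ^ 2 ^ K) ^ (collisions p).card else 0)
      ≤ (1 / 2) ^ d := by
  set t : ℝ := 2 * Real.exp 1 with ht
  have ht1 : 1 ≤ t := by
    have := Real.add_one_le_exp (1 : ℝ)
    linarith
  have ht0 : 0 < t := one_pos.trans_le ht1
  have hℓ0 : (0 : ℝ) < ℓ := by exact_mod_cast NeZero.pos ℓ
  calc _ ≤ 𝔼 p : Fin K → (Fin m → Fin ℓ) × (Fin m → Fin ℓ),
          (t ^ d)⁻¹ * (t * 2 ^ 2 ^ K) ^ (collisions p).card := by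
        refine expect_le_expect fun p _ => ?_
        split_ifs with h
        · rw [mul_pow t, ← mul_assoc]
          refine le_mul_of_one_le_left (by positivity) ?_
          rw [← div_eq_inv_mul, one_le_div (by positivity)]
          exact pow_le_pow_right₀ ht1 h
        · positivity
    _ ≤ (t ^ d)⁻¹ * (1 + t * 2 ^ 2 ^ K * K / ℓ) ^ m := by
        rw [← mul_expect]
        exact mul_le_mul_of_nonneg_left (expect_pow_card_collisions_le (by positivity))
          (by positivity)
    _ ≤ (t ^ d)⁻¹ * Real.exp d := by
        refine mul_le_mul_of_nonneg_left ?_ (by positivity)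
        calc (1 + t * 2 ^ 2 ^ K * K / ℓ) ^ m ≤ Real.exp (t * 2 ^ 2 ^ K * K / ℓ) ^ m := by
              refine pow_le_pow_left₀ (by positivity) ?_ m
              rw [add_comm]
              exact Real.add_one_le_exp _
          _ = Real.exp (m * (t * 2 ^ 2 ^ K * K / ℓ)) := (Real.exp_nat_mul _ _).symm
          _ ≤ Real.exp d := by
              rw [Real.exp_le_exp, ← mul_div_assoc, div_le_iff₀ hℓ0]
              linarith
    _ = (1 / 2) ^ d := by
        rw [← Real.exp_one_pow, ← inv_pow, ← mul_pow, ht]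
        congr 1
        field_simp

/-- The weight `ψ` on the selected bits has small correlation with cylinder intersections, for
any encoding of the string `x` and the choices `y` as inputs of the `K + 1` players. -/
theorem discrepancy_pow_le {K m d ℓ : ℕ} [NeZero ℓ] {X : Fin (K + 1) → Type}
    {ψ : (Fin m → Bool) → ℝ} (hψ : ∑ z, |ψ z| = 1)
    (hψd : ∀ h ∈ lowDegree m d, ∑ z, ψ z * h z = 0)
    (hℓ : 2 * Real.exp 1 * m * 2 ^ 2 ^ K * K ≤ d * ℓ)
    (a : (Fin m × (Fin K → Fin ℓ) → Bool) → X 0)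
    (b : (j : Fin K) → (Fin m → Fin ℓ) → X j.succ)
    {φ : Fin (K + 1) → ((j : Fin (K + 1)) → X j) → ℝ} (hφ : ∀ i, IsCylinder i (φ i)) :
    |𝔼 y : Fin K → Fin m → Fin ℓ, 𝔼 x, 2 ^ m * ψ (fun i => x (window y i)) *
        ∏ i, φ i (Fin.cons (a x) fun j => b j (y j))| ^ 2 ^ K ≤ (1 / 2) ^ d := by
  -- Player 0 does not see `x`, so any fixed string may replace it in `φ 0`.
  have hrew : ∀ x (y : Fin K → Fin m → Fin ℓ), ∏ i, φ i (Fin.cons (a x) fun j => b j (y j))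
      = φ 0 (Fin.cons (a default) fun j => b j (y j)) *
        ∏ j : Fin K, φ j.succ (Fin.cons (a x) fun j => b j (y j)) := by
    intro x y
    rw [Fin.prod_univ_succ]
    congr 1
    refine (hφ 0).1 _ _ fun j hj => ?_
    obtain ⟨j, rfl⟩ := Fin.exists_succ_eq.2 hj
    simp
  simp_rw [hrew]
  refine (abs_expect_cylinder_pow_le K
    (fun (x : Fin m × (Fin K → Fin ℓ) → Bool) y => 2 ^ m * ψ (fun i => x (window y i)))
    (fun y => φ 0 (Fin.cons (a default) fun j => b j (y j)))
    (fun j x y => φ j.succ (Fin.cons (a x) fun j => b j (y j)))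
    (fun _ => (hφ _).2 _) (fun _ _ _ => (hφ _).2 _) fun j x y y' hy => ?_).trans
    ((expect_le_expect fun p _ => abs_expect_prod_window_le hψ hψd p).trans
      (expect_collisions_tail_le hℓ))
  refine (hφ _).1 _ _ fun l => ?_
  refine Fin.cases (fun _ => rfl) (fun l hl => ?_) l
  simp only [Fin.cons_succ]
  rw [hy l fun h => hl (by rw [h])]

/-! ### Encoding into the masking scheme -/

lemma select_eq_padZero {m n : ℕ} {S : Finset (Fin n)} {e : Fin m → Fin n} (he : StrictMono e)
    (hS : ∀ c, c ∈ S ↔ ∃ i, e i = c) (x : Fin n → Bool) :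
    select S x = padZero n fun i => x (e i) := by
  have hcard : S.card = m := by
    have : S = univ.image e := by
      ext c
      simp [hS]
    rw [this, card_image_of_injective _ he.injective, card_univ, Fintype.card_fin]
  have he' := S.orderEmbOfFin_unique hcard (fun i => (hS _).2 ⟨i, rfl⟩) he
  funext j
  unfold select padZero
  by_cases hj : (j : ℕ) < m
  · rw [dif_pos hj, dif_pos (hcard.symm ▸ hj)]
    congr 1
    rw [he']
    exact orderEmbOfFin_eq_orderEmbOfFin_iff.2 rfl
  · rw [dif_neg hj, dif_neg (hcard.symm ▸ hj)]

/-- The position of a cell of the `m` blocks in the string of length `n`. -/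
def cellPos {K m ℓ n : ℕ} (h : m * ℓ ^ K ≤ n) (b : Fin m × (Fin K → Fin ℓ)) : Fin n :=
  Fin.castLE h (finProdFinEquiv (b.1, finFunctionFinEquiv b.2))

lemma cellPos_injective {K m ℓ n : ℕ} (h : m * ℓ ^ K ≤ n) :
    Function.Injective (cellPos h : Fin m × (Fin K → Fin ℓ) → Fin n) := by
  intro b b' hb
  have := finProdFinEquiv.injective (Fin.castLE_injective h hb)
  rw [Prod.mk.injEq] at this
  exact Prod.ext this.1 (finFunctionFinEquiv.injective this.2)

/-- The block is the leading digit of the position, so the selected bits appear in block order. -/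
lemma cellPos_lt {K m ℓ n : ℕ} (h : m * ℓ ^ K ≤ n) {b b' : Fin m × (Fin K → Fin ℓ)}
    (hb : b.1 < b'.1) : cellPos h b < cellPos h b' := by
  rw [Fin.lt_def]
  simp only [cellPos, Fin.val_castLE, finProdFinEquiv_apply_val]
  have h1 := (finFunctionFinEquiv b.2).isLt
  have h2 : ℓ ^ K * ((b.1 : ℕ) + 1) ≤ ℓ ^ K * b'.1 := Nat.mul_le_mul_left _ hb
  rw [Nat.mul_add, mul_one] at h2
  omega

/-- The string on the forehead of player `0`: `x` in the cells, and zero elsewhere. -/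
noncomputable def encodeString {K m ℓ n : ℕ} (h : m * ℓ ^ K ≤ n) (x : Fin m × (Fin K → Fin ℓ) → Bool) :
    Fin n → Bool :=
  Function.extend (cellPos h) x fun _ => false

/-- The string on the forehead of player `j + 1`: the indicator of the cells whose `j`-th
coordinate is the one that `y` chooses in their block. -/
noncomputable def encodeMask {K m ℓ n : ℕ} (h : m * ℓ ^ K ≤ n) (j : Fin K) (y : Fin m → Fin ℓ) :
    Fin n → Bool :=
  Function.extend (cellPos h) (fun b => decide (b.2 j = y b.1)) fun _ => false

theorem maskedFun_encode {K m ℓ n : ℕ} (hK : 1 ≤ K) (h : m * ℓ ^ K ≤ n)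
    (f : (Fin m → Bool) → ℤˣ) (f' : (Fin n → Bool) → ℤˣ)
    (hf' : ∀ z : Fin m → Bool, f z = f' (padZero n z))
    (x : Fin m × (Fin K → Fin ℓ) → Bool) (y : Fin K → Fin m → Fin ℓ) :
    maskedFun (K + 1) f' (Fin.cons (encodeString h x) fun j => encodeMask h j (y j))
      = f fun i => x (window y i) := by
  have hmono : StrictMono fun i => cellPos h (window y i) := fun i i' hi => cellPos_lt h hi
  rw [maskedFun, select_eq_padZero hmono, hf']
  · congr 2
    funext i
    simp [encodeString, (cellPos_injective h).extend_apply]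
  · intro c
    simp only [mem_filter, mem_univ, true_and]
    rw [Fin.forall_fin_succ]
    simp only [ne_eq, not_true_eq_false, false_imp_iff, true_and, Fin.succ_ne_zero,
      not_false_eq_true, true_imp_iff, Fin.cons_succ]
    by_cases hc : ∃ b, cellPos h b = c
    · obtain ⟨b, rfl⟩ := hc
      simp only [encodeMask, (cellPos_injective h).extend_apply, decide_eq_true_iff,
        (cellPos_injective h).eq_iff]
      constructor
      · intro hb
        exact ⟨b.1, Prod.ext rfl (funext fun j => (hb j).symm)⟩
      · rintro ⟨i, rfl⟩ j
        rfl
    · constructor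
      · intro hb
        -- Outside the cells all masks are zero; excluding such positions takes at least one mask,
        -- hence `1 ≤ K`.
        have := hb ⟨0, hK⟩
        rw [encodeMask, Function.extend_apply' _ _ _ hc] at this
        exact absurd this (by simp)
      · rintro ⟨i, rfl⟩
        exact absurd ⟨_, rfl⟩ hc

/-! ### The lower bound -/

lemma IsApproxDegree.le {m d : ℕ} {δ : ℝ} {f : (Fin m → Bool) → ℤˣ}
    (hf : IsApproxDegree δ f d) : d ≤ m := by
  obtain ⟨φ, rfl, -⟩ := hf.1
  exact Finset.sup_le fun S _ => (card_le_univ S).trans_eq (Fintype.card_fin m)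

/-- Sizes of the blocks for which the encoding fits and the discrepancy is small. -/
lemma exists_blockSize {K m n d : ℕ} (hK : 1 ≤ K) (hd : 1 ≤ d) (hdm : d ≤ m)
    (hn : (2 ^ 2 ^ (K + 1) * (K : ℝ) * Real.exp 1 / (d : ℝ)) ^ K * (m : ℝ) ^ (K + 1) ≤ (n : ℝ)) :
    ∃ ℓ : ℕ, 0 < ℓ ∧ m * ℓ ^ K ≤ n ∧
      2 * Real.exp 1 * m * 2 ^ 2 ^ K * K ≤ (d : ℝ) * ℓ := by
  have hd0 : (0 : ℝ) < d := by exact_mod_cast hd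
  have hdm' : (d : ℝ) ≤ m := by exact_mod_cast hdm
  have hm0 : (0 : ℝ) < m := hd0.trans_le hdm'
  have hK1 : (1 : ℝ) ≤ K := by exact_mod_cast hK
  have he : (1 : ℝ) ≤ Real.exp 1 := Real.one_le_exp zero_le_one
  have h2K : 2 ≤ 2 ^ K := by simpa using Nat.pow_le_pow_right two_pos hK
  have hW : (4 : ℝ) ≤ 2 ^ 2 ^ K := by
    calc (4 : ℝ) = 2 ^ 2 := by norm_num
      _ ≤ 2 ^ 2 ^ K := pow_le_pow_right₀ one_le_two h2K
  set W : ℝ := 2 ^ 2 ^ K with hWdef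
  have hWW : (2 : ℝ) ^ 2 ^ (K + 1) = W * W := by
    rw [hWdef, ← pow_add, pow_succ, mul_two]
  rw [hWW] at hn
  -- With this `L` the size hypothesis reads `m * L ^ K ≤ n`. One factor `W` meets the discrepancy
  -- condition; the other, at least 4, pays for its constant 2 and for the loss of at most half in
  -- rounding `L ≥ 2` down.
  set L : ℝ := W * W * K * Real.exp 1 * m / d with hL
  have hL1 : 2 ≤ L := by
    rw [hL, le_div_iff₀ hd0]
    have h1 : (2 : ℝ) ≤ W * W := by nlinarith
    have h2 : (2 : ℝ) ≤ W * W * K := by nlinarith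
    have h3 : (2 : ℝ) ≤ W * W * K * Real.exp 1 := by nlinarith
    exact mul_le_mul h3 hdm' hd0.le (by linarith)
  have hfloor : L / 2 ≤ (⌊L⌋₊ : ℝ) := by
    have := Nat.lt_floor_add_one L
    linarith
  refine ⟨⌊L⌋₊, Nat.floor_pos.2 (by linarith), ?_, ?_⟩
  · have hLn : (m : ℝ) * L ^ K ≤ n := by
      refine le_of_eq_of_le ?_ hn
      rw [hL, mul_div_right_comm _ (m : ℝ), mul_pow]
      ring
    have : (m : ℝ) * (⌊L⌋₊ : ℝ) ^ K ≤ n := by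
      refine le_trans ?_ hLn
      gcongr
      exact Nat.floor_le (by linarith)
    exact_mod_cast this
  · calc 2 * Real.exp 1 * m * W * K ≤ Real.exp 1 * m * W * K * (W / 2) := by
          have : 0 ≤ Real.exp 1 * m * W * K := by positivity
          nlinarith
      _ = d * (L / 2) := by
          rw [hL]
          field_simp
      _ ≤ d * (⌊L⌋₊ : ℝ) := by gcongr

/-- A weighted sum over the encoded inputs that depends on the selected bits only. -/
lemma expect_window {K m ℓ : ℕ} [NeZero ℓ] (h : (Fin m → Bool) → ℝ) :
    𝔼 y : Fin K → Fin m → Fin ℓ, 𝔼 x : Fin m × (Fin K → Fin ℓ) → Bool,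
      2 ^ m * h (fun i => x (window y i)) = ∑ z, h z := by
  have : ∀ y : Fin K → Fin m → Fin ℓ, 𝔼 x : Fin m × (Fin K → Fin ℓ) → Bool,
      2 ^ m * h (fun i => x (window y i)) = ∑ z, h z := by
    intro y
    rw [expect_comp_injective (fun z => 2 ^ m * h z) (window_injective y), ← mul_expect,
      Fintype.expect_eq_sum_div_card]
    simp only [Fintype.card_fun, Fintype.card_bool, Fintype.card_fin]
    push_cast
    field_simp
  simp_rw [this]
  exact Fintype.expect_const _

theorem cost_lower_bound {K m n d : ℕ} (hK : 1 ≤ K) (hd : 1 ≤ d) {δ ε : ℝ}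
    {f : (Fin m → Bool) → ℤˣ} (hf : IsApproxDegree δ f d)
    (hn : (2 ^ 2 ^ (K + 1) * (K : ℝ) * Real.exp 1 / (d : ℝ)) ^ K * (m : ℝ) ^ (K + 1) ≤ (n : ℝ))
    {f' : (Fin n → Bool) → ℤˣ} (hf' : ∀ z : Fin m → Bool, f z = f' (padZero n z))
    (hε : 0 < δ + 2 * ε - 1) {c : ℕ}
    (P : RandProtocol fun _ : Fin (K + 1) => Fin n → Bool) (hc : P.CostLE c)
    (hP : P.ComputesWithAdvantage (maskedFun (K + 1) f') ε) :
    (d : ℝ) / 2 ^ K + Real.logb 2 (δ + 2 * ε - 1) ≤ c := by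
  obtain ⟨ℓ, hℓ0, hℓn, hℓd⟩ := exists_blockSize hK hd hf.le hn
  have : NeZero ℓ := ⟨hℓ0.ne'⟩
  obtain ⟨ψ, hψ1, hψf, hψd⟩ := exists_dual_witness hd hf
  set Ω := (Fin K → Fin m → Fin ℓ) × (Fin m × (Fin K → Fin ℓ) → Bool)
  set θ : Ω → ℝ := fun a => 2 ^ m * ψ (fun i => a.2 (window a.1 i)) / Fintype.card Ω with hθ
  set w : Ω → Fin (K + 1) → Fin n → Bool := fun a =>
    Fin.cons (encodeString hℓn a.2) fun j => encodeMask hℓn j (a.1 j) with hw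
  have hcard : (0 : ℝ) < Fintype.card Ω := by exact_mod_cast Fintype.card_pos
  have hsum : ∀ g : Ω → ℝ, ∑ a, g a / Fintype.card Ω = 𝔼 y, 𝔼 x, g (y, x) := by
    intro g
    rw [← sum_div, ← Fintype.expect_eq_sum_div_card, ← univ_product_univ, expect_product]
  have hθ1 : ∑ a, |θ a| = 1 := by
    rw [← hψ1, ← expect_window (K := K) (ℓ := ℓ) fun z => |ψ z|,
      ← hsum fun a => 2 ^ m * |ψ fun i => a.2 (window a.1 i)|]
    refine sum_congr rfl fun a _ => ?_
    simp only [hθ]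
    rw [abs_div, abs_mul, abs_of_pos hcard, abs_of_pos (by positivity : (0 : ℝ) < 2 ^ m)]
  have hθF : δ < ∑ a, θ a * ((maskedFun (K + 1) f' (w a) : ℤ) : ℝ) := by
    refine lt_of_lt_of_eq hψf ?_
    rw [← expect_window (K := K) (ℓ := ℓ) fun z => ψ z * ((f z : ℤ) : ℝ),
      ← hsum fun a => 2 ^ m * (ψ (fun i => a.2 (window a.1 i)) *
        ((f fun i => a.2 (window a.1 i) : ℤ) : ℝ))]
    refine sum_congr rfl fun a _ => ?_
    rw [hw, maskedFun_encode hK hℓn f f' hf']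
    simp only [hθ]
    ring
  set B : ℝ := 2 ^ (-((d : ℝ) / 2 ^ K)) with hB
  have hB0 : 0 < B := Real.rpow_pos_of_pos two_pos _
  have hBpow : B ^ 2 ^ K = (1 / 2) ^ d := by
    rw [hB, ← Real.rpow_mul_natCast two_pos.le, Nat.cast_pow, Nat.cast_two, neg_mul,
      div_mul_cancel₀ _ (by positivity), Real.rpow_neg two_pos.le, Real.rpow_natCast, one_div,
      inv_pow]
  have hdisc : ∀ φ : Fin (K + 1) → (Fin (K + 1) → Fin n → Bool) → ℝ,
      (∀ i, IsCylinder i (φ i)) → |∑ a, θ a * ∏ i, φ i (w a)| ≤ B := by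
    intro φ hφ
    rw [← pow_le_pow_iff_left₀ (abs_nonneg _) hB0.le (pow_ne_zero K two_ne_zero), hBpow]
    refine le_of_eq_of_le ?_ (discrepancy_pow_le hψ1 hψd hℓd (encodeString hℓn)
      (encodeMask hℓn) hφ)
    rw [← hsum fun a => 2 ^ m * ψ (fun i => a.2 (window a.1 i)) * ∏ i, φ i (w a)]
    congr 2
    refine sum_congr rfl fun a _ => ?_
    simp only [hθ]
    ring
  have hmain := RandProtocol.correlation_le θ w hθ1 hdisc P hc hP
  have hlt : δ + 2 * ε - 1 ≤ 2 ^ ((c : ℝ) - d / 2 ^ K) := by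
    rw [sub_eq_add_neg (c : ℝ), Real.rpow_add two_pos, Real.rpow_natCast]
    linarith
  have hlog := (Real.logb_le_iff_le_rpow one_lt_two hε).2 hlt
  linarith

end NOF

theorem mainTheorem1 (k m n d : ℕ) [NeZero k] (hk : 2 ≤ k) (hd : 1 ≤ d) (δ ε : ℝ)
    (f : (Fin m → Bool) → ℤˣ) (hf : NOF.IsApproxDegree δ f d)
    (hn : (2 ^ 2 ^ k * ((k : ℝ) - 1) * Real.exp 1 / (d : ℝ)) ^ (k - 1) * (m : ℝ) ^ k ≤ (n : ℝ))
    (f' : (Fin n → Bool) → ℤˣ) (hf' : ∀ z : Fin m → Bool, f z = f' (NOF.padZero n z))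
    (hε : 0 < δ + 2 * ε - 1) :
    (((d : ℝ) / 2 ^ (k - 1) + Real.logb 2 (δ + 2 * ε - 1) : ℝ) : EReal) ≤
      ((NOF.randComplexity (X := fun _ : Fin k => Fin n → Bool) ε (NOF.maskedFun k f') : ℕ∞) :
        EReal) := by
  obtain ⟨K, rfl⟩ : ∃ K, k = K + 1 := ⟨k - 1, by omega⟩
  have hK : 1 ≤ K := by omega
  simp only [Nat.add_sub_cancel, Nat.cast_add, Nat.cast_one, add_sub_cancel_right] at hn ⊢
  set r : ℝ := (d : ℝ) / 2 ^ K + Real.logb 2 (δ + 2 * ε - 1) with hr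
  -- Costs are natural numbers, so the real bound may be rounded up (to 0 if negative) before taking
  -- the infimum in `ℕ∞`.
  have hle : ((⌈r⌉₊ : ℕ) : ℕ∞) ≤
      NOF.randComplexity (X := fun _ : Fin (K + 1) => Fin n → Bool) ε
        (NOF.maskedFun (K + 1) f') := by
    refine le_iInf₂ fun c ⟨P, hc, hP⟩ => ?_
    exact Nat.cast_le.2 <| Nat.ceil_le.2 (NOF.cost_lower_bound hK hd hf hn hf' hε P hc hP)
  calc (r : EReal) ≤ ((⌈r⌉₊ : ℝ) : EReal) := EReal.coe_le_coe_iff.2 (Nat.le_ceil r)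
    _ = (((⌈r⌉₊ : ℕ) : ℕ∞) : EReal) := by
        rw [ENat.toENNReal_coe]
        rfl
    _ ≤ _ := by exact_mod_cast hle
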